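/- Let $n\ge 0$ and let $P\subseteq\mathbb{R}^n$ be an $n$-dimensional lattice simplex, i.e. the convex hull of affinely independent points $v_0,\dots,v_n\in\mathbb{Z}^n$. For a nonempty face $F$ of $P$ (the set where some linear functional attains its maximum over $P$; the zero functional gives $P$ itself) let $\operatorname{Vol}_{\mathbb{Z}}(F)$ be its normalized volume, i.e. the translation-invariant volume on the affine span $\operatorname{aff}(F)$, scaled so that a fundamental parallelepiped of the affine lattice $\operatorname{aff}(F)\cap\mathbb{Z}^n$ has volume $\dim(F)!$. Let $\mathcal{F}(P)_j$ be the set of $j$-dimensional faces of $P$, and put $$c(P):=\sum_{j=0}^n(-1)^{n-j}(j+1)\sum_{F\in\mathcal{F}(P)_j}\operatorname{Vol}_{\mathbb{Z}}(F).$$ For $I\subseteq\{0,\dots,n\}$ let $$s_I:=\Bigl|\Bigl\{x\in\mathbb{Z}^{n+1} : x=\sum_{i\in I}\lambda_i\,(v_i,1)\ \text{with } 0<\lambda_i<1 \text{ for all } i\in I\Bigr\}\Bigr|,$$ so that $s_\emptyset=1$. Then $$c(P)\ge 0,\qquad\text{and more precisely}\qquad c(P)=\sum_{I\subseteq\{0,\dots,n\}}\binom{|I|}{n}\,s_I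 .$$ In particular, Di Rocco's conjecture that $c(P)\ge 0$ for every $n$-dimensional lattice polytope $P\subset\mathbb{R}^n$ holds for simplices. -/

import Mathlib

open MeasureTheory

noncomputable section

namespace LatticePolytope

/-- The lattice `ℤⁿ` inside `ℝⁿ`. -/
def intLattice (n : ℕ) : Submodule ℤ (Fin n → ℝ) :=
  Submodule.span ℤ (Set.range (Pi.basisFun ℝ (Fin n)))

/-- The dimension of a (nonempty) set: the dimension of its affine span. -/
def dim {n : ℕ} (F : Set (Fin n → ℝ)) : ℕ :=
  Module.finrank ℝ (vectorSpan ℝ F)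

/-- The lattice of integer vectors parallel to the affine span of `F`. When the affine span of `F`
contains a lattice point `p`, one has `aff(F) ∩ ℤⁿ = p + latticeOf F`. -/
def latticeOf {n : ℕ} (F : Set (Fin n → ℝ)) : Submodule ℤ (vectorSpan ℝ F) :=
  ZLattice.comap ℝ (intLattice n) (vectorSpan ℝ F).subtype

/-- A set `F`, seen from one of its points `p` as a subset of the direction space of its affine
span. -/
def chart {n : ℕ} (F : Set (Fin n → ℝ)) (p : Fin n → ℝ) : Set (vectorSpan ℝ F) :=
  {w | p + (w : Fin n → ℝ) ∈ F}

open Classical in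
/-- The normalized volume `Vol_ℤ(F)`: the volume on the affine span of `F`, scaled so that a
fundamental parallelepiped of `aff(F) ∩ ℤⁿ` has volume `dim(F)!`. It is the quotient of the
Haar measure of `F` by that of a fundamental domain of the lattice, times `dim(F)!`; neither the
normalization of the Haar measure nor the base point matters. -/
def normalizedVolume {n : ℕ} (F : Set (Fin n → ℝ)) : ℝ :=
  if h : F.Nonempty then
    (Nat.factorial (dim F) : ℝ) *
      ((Measure.addHaar : Measure (vectorSpan ℝ F)).real (chart F h.some) /
        ZLattice.covolume (latticeOf F) Measure.addHaar)
  else 0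

/-- The normalized volume does not depend on the base point. -/
theorem normalizedVolume_eq {n : ℕ} (F : Set (Fin n → ℝ)) {p : Fin n → ℝ} (hp : p ∈ F) :
    normalizedVolume F = (Nat.factorial (dim F) : ℝ) *
      ((Measure.addHaar : Measure (vectorSpan ℝ F)).real (chart F p) /
        ZLattice.covolume (latticeOf F) Measure.addHaar) := by
  have h : F.Nonempty := ⟨p, hp⟩
  have hq := h.some_mem
  set q := h.some with hqdef
  let d : vectorSpan ℝ F := ⟨q - p, vsub_mem_vectorSpan ℝ hq hp⟩
  have hc : chart F q = (fun w => d + w) ⁻¹' chart F p := by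
    ext w
    simp only [chart, Set.mem_ofPred_eq, Set.mem_preimage, Submodule.coe_add, d]
    rw [show p + (q - p + (w : Fin n → ℝ)) = q + w by abel]
  rw [normalizedVolume, dif_pos h, ← hqdef, hc]
  simp only [Measure.real, measure_preimage_add]

/-- The set of `j`-dimensional (nonempty) faces of `P`: a face is the locus of `P` where some linear
functional attains its maximum over `P` (the zero functional gives `P` itself). -/
def faces {n : ℕ} (P : Set (Fin n → ℝ)) (j : ℕ) : Set (Set (Fin n → ℝ)) :=
  {F | IsExposed ℝ P F ∧ F.Nonempty ∧ dim F = j}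

/-- The invariant `c(P) = ∑_{j=0}^n (-1)^{n-j} (j+1) ∑_{F a j-dimensional face of P} Vol_ℤ(F)` of an
`n`-dimensional lattice polytope `P ⊆ ℝⁿ`. A polytope has finitely many faces, so that the inner
sum is a finite sum. -/
def c {n : ℕ} (P : Set (Fin n → ℝ)) : ℝ :=
  ∑ j ∈ Finset.range (n + 1),
    (-1 : ℝ) ^ (n - j) * ((j : ℝ) + 1) * ∑ᶠ F ∈ faces P j, normalizedVolume F

/-- A lattice point of `ℤᵐ`, as a point of `ℝᵐ`. -/
def toReal {m : ℕ} (x : Fin m → ℤ) : Fin m → ℝ := fun k => (x k : ℝ)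

/-- The point `(x, 1)` of `ℤⁿ⁺¹`, for `x ∈ ℤⁿ`. -/
def lift {n : ℕ} (x : Fin n → ℤ) : Fin (n + 1) → ℤ := Fin.snoc (α := fun _ => ℤ) x 1

/-- The number `s_I` of lattice points `x ∈ ℤⁿ⁺¹` of the form `x = ∑_{i ∈ I} lᵢ (vᵢ, 1)` with
`0 < lᵢ < 1` for all `i ∈ I`. For `I = ∅` it is `1`, the empty sum `0` being the only such point. -/
def s {n : ℕ} (v : Fin (n + 1) → Fin n → ℤ) (I : Finset (Fin (n + 1))) : ℕ :=
  Set.ncard {x : Fin (n + 1) → ℤ | ∃ l : Fin (n + 1) → ℝ,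
    (∀ i ∈ I, 0 < l i ∧ l i < 1) ∧ toReal x = ∑ i ∈ I, l i • toReal (lift (v i))}

end LatticePolytope

end

/-!
The normalized volume of the face with vertices `vᵢ`, `i ∈ J`, is the index of the lattice generated
by its edges in the lattice of the face. The points of the half-open parallelepiped over the
`(vᵢ, 1)`, `i ∈ J`, represent the cosets, so it equals the number of these points. Sorting them by
the support of their coefficients gives `Vol = ∑_{I ⊆ J} s_I`. In the alternating sum `c(P)`, the
coefficient of `s_I` is then, by inclusion–exclusion over the sets `J ⊇ I`, the number of vertices
`j` with `I ∪ {j} = {0, …, n}`, which is `|I|.choose n`.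
-/

namespace LatticePolytope

open Module

section SolidSimplex

/-- The corner of the nonnegative orthant cut off by the hyperplane `∑ xᵢ = t`; for `t = 1` this
is the convex hull of the origin and the standard basis vectors. -/
def solidSimplex (ι : Type*) [Fintype ι] (t : ℝ) : Set (ι → ℝ) :=
  {x | (∀ i, 0 ≤ x i) ∧ ∑ i, x i ≤ t}

theorem measurableSet_solidSimplex (ι : Type*) [Fintype ι] (t : ℝ) :
    MeasurableSet (solidSimplex ι t) := by
  unfold solidSimplex
  measurability

theorem volume_solidSimplex_fin_succ (d : ℕ) (t : ℝ) :
    volume (solidSimplex (Fin (d + 1)) t) =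
      ∫⁻ a in Set.Icc 0 t, volume (solidSimplex (Fin d) (t - a)) := by
  let e := MeasurableEquiv.piFinSuccAbove (fun _ : Fin (d + 1) => ℝ) 0
  have hm := measurableSet_solidSimplex (Fin (d + 1)) t
  have hslice : ∀ a, volume (Prod.mk a ⁻¹' (e.symm ⁻¹' solidSimplex (Fin (d + 1)) t)) =
      (Set.Icc 0 t).indicator (fun a => volume (solidSimplex (Fin d) (t - a))) a := by
    intro a
    have hmem : ∀ x : Fin d → ℝ, e.symm (a, x) ∈ solidSimplex (Fin (d + 1)) t ↔
        0 ≤ a ∧ x ∈ solidSimplex (Fin d) (t - a) := fun x => by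
      simp [e, solidSimplex, MeasurableEquiv.piFinSuccAbove, Fin.forall_fin_succ,
        Fin.sum_univ_succ, and_assoc, le_sub_iff_add_le']
    by_cases ha : a ∈ Set.Icc 0 t
    · rw [Set.indicator_of_mem ha]
      exact congrArg volume (Set.ext fun x => (hmem x).trans (and_iff_right ha.1))
    · rw [Set.indicator_of_notMem ha]
      refine (congrArg volume (Set.eq_empty_of_forall_notMem fun x hx => ?_)).trans measure_empty
      obtain ⟨h0, hx0, hsum⟩ := (hmem x).1 hx
      exact ha ⟨h0, sub_nonneg.1 ((Finset.sum_nonneg fun i _ => hx0 i).trans hsum)⟩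
  rw [← (volume_preserving_piFinSuccAbove (fun _ => ℝ) (0 : Fin (d + 1))).symm.measure_preimage
    hm.nullMeasurableSet, Measure.volume_eq_prod, Measure.prod_apply (e.symm.measurable hm),
    lintegral_congr hslice, lintegral_indicator measurableSet_Icc]

theorem volume_solidSimplex_fin (d : ℕ) {t : ℝ} (ht : 0 ≤ t) :
    volume (solidSimplex (Fin d) t) = ENNReal.ofReal (t ^ d / d.factorial) := by
  induction d generalizing t with
  | zero => simp [solidSimplex, ht, volume_pi]
  | succ d ih =>
    have hint : ∫ a in Set.Icc 0 t, (t - a) ^ d / (d.factorial : ℝ) =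
        t ^ (d + 1) / (d + 1).factorial := by
      rw [integral_Icc_eq_integral_Ioc, ← intervalIntegral.integral_of_le ht,
        intervalIntegral.integral_comp_sub_left (fun x => x ^ d / (d.factorial : ℝ)), sub_self,
        sub_zero, intervalIntegral.integral_div, integral_pow, zero_pow d.succ_ne_zero, sub_zero,
        div_div, Nat.factorial_succ]
      push_cast
      rfl
    rw [volume_solidSimplex_fin_succ,
      setLIntegral_congr_fun measurableSet_Icc fun a ha => ih (sub_nonneg.2 ha.2),
      ← ofReal_integral_eq_lintegral_ofReal, hint]
    · exact Continuous.integrableOn_Icc (by fun_prop)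
    · refine (ae_restrict_iff' measurableSet_Icc).2 (.of_forall fun a ha => ?_)
      have := sub_nonneg.2 ha.2
      positivity

theorem volume_solidSimplex (ι : Type*) [Fintype ι] {t : ℝ} (ht : 0 ≤ t) :
    volume (solidSimplex ι t) =
      ENNReal.ofReal (t ^ Fintype.card ι / (Fintype.card ι).factorial) := by
  let e := Fintype.equivFin ι
  rw [← volume_solidSimplex_fin _ ht,
    ← (volume_measurePreserving_piCongrLeft (fun _ => ℝ) e).measure_preimage
      (measurableSet_solidSimplex (Fin (Fintype.card ι)) t).nullMeasurableSet]
  congr 1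
  ext x
  have hx : ∀ i, MeasurableEquiv.piCongrLeft (fun _ => ℝ) e x (e i) = x i :=
    Equiv.piCongrLeft_apply_apply (fun _ => ℝ) e x
  simp only [solidSimplex, Set.mem_preimage, Set.mem_ofPred_eq, ← e.sum_comp, hx,
    ← e.forall_congr_right (q := fun i => 0 ≤ MeasurableEquiv.piCongrLeft (fun _ => ℝ) e x i)]

end SolidSimplex

section HaarMeasure

variable {E ι : Type*} [NormedAddCommGroup E] [NormedSpace ℝ E] [Fintype ι]
  (b : Basis ι ℝ E) [MeasurableSpace E] [BorelSpace E] (μ : Measure E) [μ.IsAddHaarMeasure]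

theorem measureReal_preimage_equivFun (s : Set (ι → ℝ)) :
    μ.real (b.equivFun ⁻¹' s) = μ.real (ZSpan.fundamentalDomain b) * volume.real s := by
  have := b.finiteDimensional_of_finite
  let e : E ≃L[ℝ] (ι → ℝ) := b.equivFun.toContinuousLinearEquiv
  have : (μ.map e).IsAddHaarMeasure := e.isAddHaarMeasure_map μ
  obtain ⟨k, hk⟩ : ∃ k : NNReal, μ.map e = k • volume :=
    ⟨_, Measure.isAddLeftInvariant_eq_smul (μ.map e) volume⟩
  have hscale : ∀ s, μ.real (e ⁻¹' s) = k * volume.real s := fun s => by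
    have hmap : μ.map e s = μ (e ⁻¹' s) := e.toHomeomorph.toMeasurableEquiv.map_apply s
    rw [measureReal_def, ← hmap, hk]
    exact ENNReal.toReal_smul k _
  have hcube : volume.real (Set.univ.pi fun _ : ι => Set.Ico (0 : ℝ) 1) = 1 := by
    simp [measureReal_def, volume_pi_pi]
  have hfd : ZSpan.fundamentalDomain b = e ⁻¹' Set.univ.pi fun _ : ι => Set.Ico (0 : ℝ) 1 := by
    ext w
    simp [ZSpan.mem_fundamentalDomain, e]
  rw [hfd, hscale, hcube, mul_one]
  exact hscale s

theorem measureReal_preimage_equivFun_solidSimplex :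
    μ.real (b.equivFun ⁻¹' solidSimplex ι 1) =
      μ.real (ZSpan.fundamentalDomain b) / (Fintype.card ι).factorial := by
  rw [measureReal_preimage_equivFun, measureReal_def volume, volume_solidSimplex ι zero_le_one,
    one_pow, ENNReal.toReal_ofReal (by positivity), mul_one_div]

end HaarMeasure

section Covolume

variable {E ι : Type*} [NormedAddCommGroup E] [NormedSpace ℝ E]

theorem covolume_div_covolume_eq_relIndex [FiniteDimensional ℝ E] [MeasurableSpace E]
    [BorelSpace E] (μ : Measure E) [μ.IsAddHaarMeasure] (L₁ L₂ : Submodule ℤ E)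
    [DiscreteTopology L₁] [IsZLattice ℝ L₁] [DiscreteTopology L₂] [IsZLattice ℝ L₂]
    (h : L₁ ≤ L₂) :
    ZLattice.covolume L₁ μ / ZLattice.covolume L₂ μ =
      L₁.toAddSubgroup.relIndex L₂.toAddSubgroup := by
  classical
  have := ZLattice.module_free ℝ L₁
  have := ZLattice.module_finite ℝ L₁
  have := ZLattice.module_free ℝ L₂
  have := ZLattice.module_finite ℝ L₂
  let b₁ := Free.chooseBasis ℤ L₁
  let b₂ := (Free.chooseBasis ℤ L₂).reindex
    (((Free.chooseBasis ℤ L₂).ofZLatticeBasis ℝ).indexEquiv (b₁.ofZLatticeBasis ℝ))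
  have hdet : ((b₂.det fun i => (⟨b₁ i, h (b₁ i).2⟩ : L₂) : ℤ) : ℝ) =
      (b₂.ofZLatticeBasis ℝ).det (b₁.ofZLatticeBasis ℝ) := by
    rw [Basis.det_apply, Basis.det_apply, Int.cast_det]
    congr 1
    ext i j
    rw [Matrix.map_apply, Basis.toMatrix_apply, Basis.toMatrix_apply,
      ← b₂.ofZLatticeBasis_repr_apply ℝ L₂, Basis.ofZLatticeBasis_apply]
  have h₂ : μ.real (ZSpan.fundamentalDomain (b₂.ofZLatticeBasis ℝ)) ≠ 0 :=
    ENNReal.toReal_ne_zero.2 ⟨ZSpan.measure_fundamentalDomain_ne_zero _,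
      (ZSpan.fundamentalDomain_isBounded _).measure_lt_top.ne⟩
  rw [AddSubgroup.relIndex_eq_natAbs_det L₁.toAddSubgroup L₂.toAddSubgroup h b₁ b₂,
    Nat.cast_natAbs, Int.cast_abs,
    ZLattice.covolume_eq_measure_fundamentalDomain L₁ μ (ZLattice.isAddFundamentalDomain b₁ μ),
    ZLattice.covolume_eq_measure_fundamentalDomain L₂ μ (ZLattice.isAddFundamentalDomain b₂ μ),
    ZSpan.measureReal_fundamentalDomain (b₁.ofZLatticeBasis ℝ) μ (b₂.ofZLatticeBasis ℝ),
    mul_div_cancel_right₀ _ h₂, ← hdet]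
  rfl

theorem relIndex_span_eq_ncard_inter_fundamentalDomain [Finite ι] (b : Basis ι ℝ E)
    {L : Submodule ℤ E} (hL : Submodule.span ℤ (Set.range b) ≤ L) :
    (Submodule.span ℤ (Set.range b)).toAddSubgroup.relIndex L.toAddSubgroup =
      ((L : Set E) ∩ ZSpan.fundamentalDomain b).ncard := by
  cases nonempty_fintype ι
  let r : L.toAddSubgroup → ((L : Set E) ∩ ZSpan.fundamentalDomain b : Set E) := fun w =>
    ⟨ZSpan.fract b (w : E), L.sub_mem w.2 (hL (ZSpan.floor b (w : E)).2),
      ZSpan.fract_mem_fundamentalDomain b w⟩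
  have hr : ∀ w z, QuotientAddGroup.leftRel ((Submodule.span ℤ
      (Set.range b)).toAddSubgroup.addSubgroupOf L.toAddSubgroup) w z ↔ r w = r z := fun w z => by
    rw [QuotientAddGroup.leftRel_apply, Subtype.ext_iff]
    exact (ZSpan.fract_eq_fract b _ _).symm
  have hsurj : Function.Surjective r := fun w =>
    ⟨⟨w, w.2.1⟩, Subtype.ext (ZSpan.fract_eq_self.2 w.2.2)⟩
  rw [AddSubgroup.relIndex, AddSubgroup.index, ← Nat.card_coe_set_eq]
  refine Nat.card_congr (Equiv.ofBijective (Quotient.lift r fun w z => (hr w z).1)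
    ⟨?_, Quotient.lift_surjective _ _ hsurj⟩)
  rintro ⟨w⟩ ⟨z⟩ h
  exact Quotient.sound ((hr w z).2 h)

theorem measureReal_fundamentalDomain_div_covolume [Finite ι] (b : Basis ι ℝ E)
    [MeasurableSpace E] [BorelSpace E] (μ : Measure E) [μ.IsAddHaarMeasure] {L : Submodule ℤ E}
    [DiscreteTopology L] (hL : Submodule.span ℤ (Set.range b) ≤ L) :
    μ.real (ZSpan.fundamentalDomain b) / ZLattice.covolume L μ =
      ((L : Set E) ∩ ZSpan.fundamentalDomain b).ncard := by
  have := b.finiteDimensional_of_finite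
  have : IsZLattice ℝ L := ⟨top_unique <| b.span_eq.ge.trans <|
    Submodule.span_mono (Submodule.subset_span.trans hL)⟩
  rw [← relIndex_span_eq_ncard_inter_fundamentalDomain b hL,
    ← covolume_div_covolume_eq_relIndex μ _ L hL,
    ZLattice.covolume_eq_measure_fundamentalDomain _ μ (ZSpan.isAddFundamentalDomain b μ)]

end Covolume

section InclusionExclusion

open Finset

variable {α : Type*} [Fintype α]

theorem sum_superset_neg_one_pow [DecidableEq α] {R : Type*} [Ring R] (I : Finset α) :
    ∑ J with I ⊆ J, (-1 : R) ^ (Fintype.card α - #J) = if I = univ then 1 else 0 := by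
  have hcompl : ∑ J with I ⊆ J, (-1 : R) ^ (Fintype.card α - #J) =
      ∑ K ∈ Iᶜ.powerset, (-1 : R) ^ #K :=
    sum_nbij' compl compl (by simp) (by simp [subset_compl_comm]) (by simp) (by simp)
      (by simp [card_compl])
  rw [hcompl]
  simpa using congrArg (Int.cast : ℤ → R) (sum_powerset_neg_one_pow_card (x := Iᶜ))

theorem sum_superset_neg_one_pow_mul_card [DecidableEq α] {R : Type*} [Ring R] (I : Finset α) :
    ∑ J with I ⊆ J, (-1 : R) ^ (Fintype.card α - #J) * #J = #{j | insert j I = univ} := by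
  calc ∑ J with I ⊆ J, (-1 : R) ^ (Fintype.card α - #J) * #J
      = ∑ J with I ⊆ J, ∑ _j ∈ J, (-1 : R) ^ (Fintype.card α - #J) :=
        sum_congr rfl fun J _ => by rw [sum_const, nsmul_eq_mul']
    _ = ∑ j, ∑ J with insert j I ⊆ J, (-1 : R) ^ (Fintype.card α - #J) :=
        sum_comm' fun J j => by simp [insert_subset_iff, and_comm]
    _ = #{j | insert j I = univ} := by
        simp only [sum_superset_neg_one_pow, sum_boole]

theorem card_filter_insert_eq_univ [DecidableEq α] {n : ℕ} (hα : Fintype.card α = n + 1)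
    (I : Finset α) :
    #{j | insert j I = univ} = (#I).choose n := by
  have hsub : ∀ j, insert j I = univ ↔ {j}ᶜ ⊆ I := fun j => by
    simp [eq_univ_iff_forall, subset_iff, or_iff_not_imp_left]
  rw [← card_powersetCard]
  refine card_bij (fun j _ => {j}ᶜ) (fun j hj => ?_)
    (fun i _ j _ h => singleton_injective (compl_injective h)) fun K hK => ?_
  · rw [mem_powersetCard, ← hsub, card_compl, card_singleton, hα]
    exact ⟨(mem_filter.1 hj).2, rfl⟩
  · rw [mem_powersetCard] at hK
    obtain ⟨j, hj⟩ := card_eq_one.1 (show #Kᶜ = 1 by rw [card_compl, hα, hK.2]; omega)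
    have hjK : {j}ᶜ = K := by rw [← hj, compl_compl]
    exact ⟨j, mem_filter.2 ⟨mem_univ j, (hsub j).2 (hjK ▸ hK.1)⟩, hjK⟩

theorem sum_neg_one_pow_mul_card_mul_sum_powerset {R : Type*} [Ring R] {n : ℕ}
    (hα : Fintype.card α = n + 1) (f : Finset α → R) :
    ∑ J, (-1 : R) ^ (Fintype.card α - #J) * #J * ∑ I ∈ J.powerset, f I =
      ∑ I, ((#I).choose n : R) * f I := by
  classical
  calc ∑ J, (-1 : R) ^ (Fintype.card α - #J) * #J * ∑ I ∈ J.powerset, f I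
      = ∑ I, ∑ J with I ⊆ J, (-1 : R) ^ (Fintype.card α - #J) * #J * f I := by
        simp only [mul_sum]
        exact sum_comm' fun J I => by simp
    _ = ∑ I, ((#I).choose n : R) * f I := by
        simp only [← sum_mul, sum_superset_neg_one_pow_mul_card, card_filter_insert_eq_univ hα]

end InclusionExclusion

section Faces

theorem eq_convexHull_inter_of_isExtreme {𝕜 E : Type*} [Field 𝕜] [LinearOrder 𝕜]
    [IsStrictOrderedRing 𝕜] [AddCommGroup E] [Module 𝕜 E] {S F : Set E}
    (hF : IsExtreme 𝕜 (convexHull 𝕜 S) F) (hconv : Convex 𝕜 F) : F = convexHull 𝕜 (S ∩ F) := by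
  refine Set.Subset.antisymm (fun x hx => ?_) (convexHull_min Set.inter_subset_right hconv)
  let A : Set E := {x ∈ convexHull 𝕜 S | x ∈ F → x ∈ convexHull 𝕜 (S ∩ F)}
  have hSA : S ⊆ A := fun y hy =>
    ⟨subset_convexHull 𝕜 S hy, fun hyF => subset_convexHull 𝕜 _ ⟨hy, hyF⟩⟩
  suffices hA : Convex 𝕜 A from (convexHull_min hSA hA (hF.subset hx)).2 hx
  rw [convex_iff_openSegment_subset]
  rintro y ⟨hy, hyF⟩ z ⟨hz, hzF⟩ w hw
  refine ⟨(convex_convexHull 𝕜 S).openSegment_subset hy hz hw, fun hwF => ?_⟩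
  exact (convex_convexHull 𝕜 _).openSegment_subset
    (hyF (hF.left_mem_of_mem_openSegment hy hz hwF hw))
    (hzF (hF.right_mem_of_mem_openSegment hy hz hwF hw)) hw

theorem convexIndependent_of_affineIndependent {𝕜 E ι : Type*} [Ring 𝕜] [PartialOrder 𝕜]
    [Nontrivial 𝕜] [AddCommGroup E] [Module 𝕜 E] {p : ι → E} (hp : AffineIndependent 𝕜 p) :
    ConvexIndependent 𝕜 p := fun s i hi =>
  (hp.mem_affineSpan_iff i s).1 (convexHull_subset_affineSpan _ hi)

theorem convexHull_image_injective {𝕜 E ι : Type*} [Ring 𝕜] [PartialOrder 𝕜] [IsOrderedRing 𝕜]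
    [AddCommGroup E] [Module 𝕜 E] {p : ι → E} (hp : ConvexIndependent 𝕜 p) :
    Function.Injective fun J : Finset ι => convexHull 𝕜 (p '' J) :=
  fun J K (h : convexHull 𝕜 (p '' J) = convexHull 𝕜 (p '' K)) => Finset.ext fun i => by
    rw [← Finset.mem_coe, ← Finset.mem_coe, ← hp.mem_convexHull_iff, h, hp.mem_convexHull_iff]

theorem isExposed_zeros_of_nonneg {E : Type*} [AddCommGroup E] [Module ℝ E] [TopologicalSpace E]
    [IsTopologicalAddGroup E] [ContinuousSMul ℝ E] [T2Space E] [FiniteDimensional ℝ E]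
    (f : E →ᵃ[ℝ] ℝ) {A : Set E} (hf : ∀ x ∈ A, 0 ≤ f x) : IsExposed ℝ A {x ∈ A | f x = 0} := by
  rintro ⟨p, hpA, hp⟩
  have hle : ∀ x y, -f.linear y ≤ -f.linear x ↔ f x ≤ f y := fun x y => by
    rw [neg_le_neg_iff, ← sub_nonneg, ← map_sub, ← vsub_eq_sub, f.linearMap_vsub, vsub_eq_sub,
      sub_nonneg]
  refine ⟨LinearMap.toContinuousLinearMap (-f.linear), Set.ext fun x => and_congr_right fun hx =>
    ⟨fun hx0 y hy => (hle x y).2 (hx0 ▸ hf y hy), fun hmax => ?_⟩⟩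
  exact (((hle x p).1 (hmax p hpA)).trans_eq hp).antisymm (hf x hx)

theorem isExposed_convexHull_image {E ι : Type*} [AddCommGroup E] [Module ℝ E]
    [TopologicalSpace E] [IsTopologicalAddGroup E] [ContinuousSMul ℝ E] [T2Space E]
    [FiniteDimensional ℝ E] [Finite ι] (B : AffineBasis ι ℝ E) (J : Finset ι) :
    IsExposed ℝ (convexHull ℝ (Set.range B)) (convexHull ℝ (B '' J)) := by
  classical
  cases nonempty_fintype ι
  let f : E →ᵃ[ℝ] ℝ := (∑ i ∈ Jᶜ, LinearMap.proj i : (ι → ℝ) →ₗ[ℝ] ℝ).toAffineMap.comp B.coords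
  have hf : ∀ x, f x = ∑ i ∈ Jᶜ, B.coord i x := fun x => by simp [f]
  have hexp := isExposed_zeros_of_nonneg f (A := convexHull ℝ (Set.range B)) fun x hx => by
    rw [B.convexHull_eq_nonneg_coord] at hx
    exact hf x ▸ Finset.sum_nonneg fun i _ => hx i
  have hvert : ∀ i, f (B i) = 0 ↔ i ∈ J := fun i => by
    simp [hf, B.coord_apply]
  convert hexp
  rw [eq_convexHull_inter_of_isExtreme hexp.isExtreme (hexp.convex (convex_convexHull ℝ _))]
  congr 1
  ext x
  constructor
  · rintro ⟨i, hi, rfl⟩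
    exact ⟨⟨i, rfl⟩, subset_convexHull ℝ _ ⟨i, rfl⟩, (hvert i).2 hi⟩
  · rintro ⟨⟨i, rfl⟩, -, hi⟩
    exact ⟨i, (hvert i).1 hi, rfl⟩

theorem vectorSpan_convexHull {𝕜 E : Type*} [Ring 𝕜] [PartialOrder 𝕜] [IsOrderedRing 𝕜]
    [AddCommGroup E] [Module 𝕜 E] (s : Set E) :
    vectorSpan 𝕜 (convexHull 𝕜 s) = vectorSpan 𝕜 s := by
  rw [← direction_affineSpan, affineSpan_convexHull, direction_affineSpan]

variable {n : ℕ} {ι : Type*}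

theorem dim_convexHull_image {p : ι → Fin n → ℝ} (hp : AffineIndependent ℝ p) {J : Finset ι}
    {j : ℕ} (hJ : J.card = j + 1) : dim (convexHull ℝ (p '' J)) = j := by
  classical
  rw [dim, vectorSpan_convexHull, ← Finset.coe_image]
  exact hp.finrank_vectorSpan_image_finset hJ

variable (B : AffineBasis ι ℝ (Fin n → ℝ))

theorem faces_convexHull_range [Finite ι] (j : ℕ) :
    faces (convexHull ℝ (Set.range B)) j =
      (fun J : Finset ι => convexHull ℝ (B '' J)) '' {J | J.card = j + 1} := by
  classical
  cases nonempty_fintype ι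
  ext F
  constructor
  · rintro ⟨hexp, hne, hdim⟩
    let J : Finset ι := {i | B i ∈ F}
    have hF : F = convexHull ℝ (B '' J) := by
      conv_lhs => rw [eq_convexHull_inter_of_isExtreme hexp.isExtreme
        (hexp.convex (convex_convexHull ℝ _))]
      simp [J, ← Set.image_preimage_eq_range_inter, Set.preimage]
    have hJ : J.card ≠ 0 := fun h0 => by
      simp [hF, Finset.card_eq_zero.1 h0] at hne
    obtain ⟨d, hd⟩ := Nat.exists_eq_succ_of_ne_zero hJ
    rw [hF, dim_convexHull_image B.ind hd] at hdim
    exact ⟨J, hd.trans (congrArg _ hdim), hF.symm⟩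
  · rintro ⟨J, hJ, rfl⟩
    have hne : J.Nonempty := Finset.card_pos.1 (hJ ▸ j.succ_pos)
    exact ⟨isExposed_convexHull_image B J, (hne.to_set.image B).convexHull,
      dim_convexHull_image B.ind hJ⟩

theorem c_convexHull_range [Fintype ι] :
    c (convexHull ℝ (Set.range B)) = ∑ J : Finset ι, (-1 : ℝ) ^ (Fintype.card ι - J.card) *
      J.card * normalizedVolume (convexHull ℝ (B '' J)) := by
  classical
  have hι : Fintype.card ι = n + 1 := by simpa using B.card_eq_finrank_add_one
  have hfaces : ∀ j, ∑ᶠ F ∈ faces (convexHull ℝ (Set.range B)) j, normalizedVolume F =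
      ∑ J ∈ (Finset.univ : Finset ι).powersetCard (j + 1),
        normalizedVolume (convexHull ℝ (B '' J)) := by
    intro j
    have hinj := convexHull_image_injective (convexIndependent_of_affineIndependent B.ind)
    rw [faces_convexHull_range, finsum_mem_image hinj.injOn, ← finsum_mem_coe_finset]
    simp [Finset.mem_powersetCard]
  rw [← Finset.powerset_univ, Finset.sum_powerset, Finset.card_univ, hι, Finset.sum_range_succ',
    Finset.powersetCard_zero, Finset.sum_singleton, Finset.card_empty, Nat.cast_zero, mul_zero,
    zero_mul, add_zero, c]
  refine Finset.sum_congr rfl fun j _ => ?_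
  rw [hfaces, Finset.mul_sum]
  refine Finset.sum_congr rfl fun J hJ => ?_
  rw [(Finset.mem_powersetCard.1 hJ).2, Nat.add_sub_add_right, Nat.cast_succ]

end Faces

section EdgeBasis

theorem convexHull_range_eq_image_stdSimplex {𝕜 E ι : Type*} [Field 𝕜] [LinearOrder 𝕜]
    [IsStrictOrderedRing 𝕜] [AddCommGroup E] [Module 𝕜 E] [Fintype ι] (p : ι → E) :
    convexHull 𝕜 (Set.range p) = Fintype.linearCombination 𝕜 p '' stdSimplex 𝕜 ι := by
  classical
  rw [← convexHull_rangle_single_eq_stdSimplex, LinearMap.image_convexHull, ← Set.range_comp]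
  congr 2
  ext i
  simp

variable {E ι : Type*} [AddCommGroup E] [Module ℝ E] {p : ι → E}

/-- The edges `p i - p k` out of the vertex `p k` of a simplex, as a basis of the direction space
of the simplex. -/
noncomputable def edgeBasis (hp : AffineIndependent ℝ p) (k : ι) :
    Basis {i // i ≠ k} ℝ (vectorSpan ℝ (convexHull ℝ (Set.range p))) :=
  (Basis.span ((affineIndependent_iff_linearIndependent_vsub ℝ p k).1 hp)).map <|
    LinearEquiv.ofEq _ _ <| by
      rw [vectorSpan_convexHull, vectorSpan_range_eq_span_range_vsub_right_ne ℝ p k]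

variable (hp : AffineIndependent ℝ p) (k : ι)

@[simp]
theorem coe_edgeBasis (i : {i // i ≠ k}) : (edgeBasis hp k i : E) = p i - p k := by
  simp [edgeBasis, Basis.span_apply]

theorem equivFun_edgeBasis_eq_iff [Fintype ι]
    (w : vectorSpan ℝ (convexHull ℝ (Set.range p))) (l : ι → ℝ) :
    (∀ i : {i // i ≠ k}, (edgeBasis hp k).equivFun w i = l i) ↔
      (w : E) = ∑ i, l i • p i - (∑ i, l i) • p k := by
  classical
  have hsum : ((edgeBasis hp k).equivFun.symm fun i => l i : E) =
      ∑ i, l i • p i - (∑ i, l i) • p k := by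
    calc ((edgeBasis hp k).equivFun.symm fun i => l i : E)
        = ∑ i : {i // i ≠ k}, l i • (p i - p k) := by simp [Basis.equivFun_symm_apply]
      _ = ∑ i, l i • (p i - p k) := by
        rw [Fintype.sum_eq_add_sum_subtype_ne _ k, sub_self, smul_zero, zero_add]
      _ = ∑ i, l i • p i - (∑ i, l i) • p k := by
        simp only [smul_sub, Finset.sum_sub_distrib, Finset.sum_smul]
  rw [← hsum, Subtype.coe_inj, LinearEquiv.eq_symm_apply, funext_iff]

end EdgeBasis

section Volume

variable {n : ℕ}

theorem mem_intLattice {x : Fin n → ℝ} : x ∈ intLattice n ↔ ∃ a : Fin n → ℤ, toReal a = x := by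
  simp only [intLattice, Basis.mem_span_iff_repr_mem, Pi.basisFun_repr, Set.mem_range,
    algebraMap_int_eq, eq_intCast, Classical.skolem, toReal, funext_iff]

theorem mem_latticeOf {F : Set (Fin n → ℝ)} {w : vectorSpan ℝ F} :
    w ∈ latticeOf F ↔ ∃ a : Fin n → ℤ, toReal a = w :=
  mem_intLattice

instance discreteTopology_latticeOf (F : Set (Fin n → ℝ)) : DiscreteTopology (latticeOf F) := by
  have : DiscreteTopology (intLattice n) :=
    inferInstanceAs (DiscreteTopology (Submodule.span ℤ (Set.range (Pi.basisFun ℝ (Fin n)))))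
  exact ZLattice.comap_discreteTopology ℝ _ continuous_subtype_val Subtype.val_injective

variable {ι : Type*}

theorem chart_convexHull_range [Fintype ι] [DecidableEq ι] {p : ι → Fin n → ℝ}
    (hp : AffineIndependent ℝ p) (k : ι) :
    chart (convexHull ℝ (Set.range p)) (p k) =
      (edgeBasis hp k).equivFun ⁻¹' solidSimplex {i // i ≠ k} 1 := by
  ext w
  refine (Set.ext_iff.1 (convexHull_range_eq_image_stdSimplex p) (p k + w)).trans ?_
  constructor
  · rintro ⟨l, ⟨hl, hsum⟩, hw⟩
    have hcoord : ∀ i : {i // i ≠ k}, (edgeBasis hp k).equivFun w i = l i := by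
      rw [equivFun_edgeBasis_eq_iff, hsum, one_smul, eq_sub_iff_add_eq', ← hw,
        Fintype.linearCombination_apply]
    rw [Fintype.sum_eq_add_sum_subtype_ne l k] at hsum
    refine ⟨fun i => hcoord i ▸ hl i, ?_⟩
    simp only [hcoord]
    linarith [hl k]
  · rintro ⟨hnonneg, hle⟩
    obtain ⟨l, hl⟩ := (Equiv.funSplitAt k ℝ).surjective
      (1 - ∑ i, (edgeBasis hp k).equivFun w i, (edgeBasis hp k).equivFun w)
    obtain ⟨hlk, hcoord⟩ := Prod.ext_iff.1 hl
    replace hcoord : ∀ i : {i // i ≠ k}, l i = (edgeBasis hp k).equivFun w i := congrFun hcoord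
    have hlsum : ∑ i, l i = 1 := by
      rw [Fintype.sum_eq_add_sum_subtype_ne l k]
      simp only [hcoord]
      exact add_eq_of_eq_sub hlk
    refine ⟨l, ⟨fun i => ?_, hlsum⟩, ?_⟩
    · by_cases hi : i = k
      · exact hi ▸ hlk.ge.trans' (sub_nonneg.2 hle)
      · exact (hcoord ⟨i, hi⟩).ge.trans' (hnonneg _)
    · rw [(equivFun_edgeBasis_eq_iff hp k w l).1 fun i => (hcoord i).symm, hlsum, one_smul,
        add_sub_cancel, Fintype.linearCombination_apply]

variable {v : ι → Fin n → ℤ} (hv : AffineIndependent ℝ fun i => toReal (v i)) (k : ι)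

theorem span_edgeBasis_le_latticeOf :
    Submodule.span ℤ (Set.range (edgeBasis hv k)) ≤ latticeOf _ := by
  rw [Submodule.span_le]
  rintro _ ⟨i, rfl⟩
  refine mem_latticeOf.2 ⟨v i - v k, ?_⟩
  rw [coe_edgeBasis]
  ext
  simp [toReal]

theorem normalizedVolume_convexHull_range [Finite ι] :
    normalizedVolume (convexHull ℝ (Set.range fun i => toReal (v i))) =
      (↑(latticeOf (convexHull ℝ (Set.range fun i => toReal (v i)))) ∩
        ZSpan.fundamentalDomain (edgeBasis hv k)).ncard := by
  classical
  cases nonempty_fintype ι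
  rw [normalizedVolume_eq _ (subset_convexHull ℝ _ (Set.mem_range_self k)),
    chart_convexHull_range hv k, measureReal_preimage_equivFun_solidSimplex, div_right_comm,
    measureReal_fundamentalDomain_div_covolume _ _ (span_edgeBasis_le_latticeOf hv k),
    dim, finrank_eq_card_basis (edgeBasis hv k)]
  field_simp

end Volume

section LatticeBox

variable {n : ℕ} {ι : Type*}

/-- The lattice points of the parallelepiped spanned by the `(vᵢ, 1)`, `i ∈ J`, with coefficients
restricted to `T`: the half-open box for `T = [0, 1)`, the open one, counted by `s`, for
`T = (0, 1)`. As in `s`, the coefficients outside `J` are arbitrary. -/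
def latticeBox (T : Set ℝ) (v : ι → Fin n → ℤ) (J : Finset ι) : Set (Fin (n + 1) → ℤ) :=
  {x | ∃ l : ι → ℝ, (∀ i ∈ J, l i ∈ T) ∧ toReal x = ∑ i ∈ J, l i • toReal (lift (v i))}

theorem toReal_injective {m : ℕ} : Function.Injective (toReal (m := m)) :=
  Int.cast_injective.comp_left

theorem toReal_eq_sum_lift_iff {v : ι → Fin n → ℤ} {J : Finset ι} {l : ι → ℝ}
    {x : Fin (n + 1) → ℤ} :
    toReal x = ∑ i ∈ J, l i • toReal (lift (v i)) ↔
      toReal (Fin.init x) = ∑ i ∈ J, l i • toReal (v i) ∧ (x (Fin.last n) : ℝ) = ∑ i ∈ J, l i := by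
  simp only [funext_iff, Fin.forall_fin_succ', Finset.sum_apply, Pi.smul_apply, toReal, lift,
    Fin.init, Fin.snoc_castSucc, Fin.snoc_last, smul_eq_mul, Int.cast_one, mul_one]

theorem latticeBox_univ_coe (T : Set ℝ) (v : ι → Fin n → ℤ) (J : Finset ι) :
    latticeBox T (fun i : J => v i) Finset.univ = latticeBox T v J := by
  classical
  ext x
  constructor
  · rintro ⟨l, hl, hx⟩
    refine ⟨fun i => if h : i ∈ J then l ⟨i, h⟩ else 0, fun i hi => ?_, ?_⟩
    · simpa [hi] using hl ⟨i, hi⟩ (Finset.mem_univ _)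
    · rw [hx, ← Finset.sum_coe_sort J]
      simp
  · rintro ⟨l, hl, hx⟩
    exact ⟨fun i => l i, fun i _ => hl i i.2, hx.trans (Finset.sum_coe_sort J _).symm⟩

/-- The projection of `ℤⁿ⁺¹` along `(a, 1)` onto `ℤⁿ`. -/
def projectAlong (a : Fin n → ℤ) (x : Fin (n + 1) → ℤ) : Fin n → ℤ :=
  Fin.init x - x (Fin.last n) • a

theorem toReal_projectAlong (a : Fin n → ℤ) (x : Fin (n + 1) → ℤ) :
    toReal (projectAlong a x) = toReal (Fin.init x) - (x (Fin.last n) : ℝ) • toReal a := by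
  ext
  simp [toReal, projectAlong]

section EdgeLattice

variable [Fintype ι] {v : ι → Fin n → ℤ}
  (hv : AffineIndependent ℝ fun i => toReal (v i)) (k : ι)

theorem mem_latticeBox_univ_iff [DecidableEq ι] (x : Fin (n + 1) → ℤ) :
    x ∈ latticeBox (Set.Ico 0 1) v Finset.univ ↔ ∃ w ∈ ZSpan.fundamentalDomain (edgeBasis hv k),
      toReal (projectAlong (v k) x) = w ∧
        x (Fin.last n) = ⌈∑ i, (edgeBasis hv k).equivFun w i⌉ := by
  simp only [latticeBox, Set.mem_ofPred_eq, toReal_eq_sum_lift_iff, toReal_projectAlong]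
  constructor
  · rintro ⟨l, hl, hx, hlast⟩
    let w := (edgeBasis hv k).equivFun.symm fun i => l i
    have hw : ∀ i : {i // i ≠ k}, (edgeBasis hv k).equivFun w i = l i :=
      congrFun ((edgeBasis hv k).equivFun.apply_symm_apply _)
    refine ⟨w, ?_, ?_, ?_⟩
    · refine (ZSpan.mem_fundamentalDomain _).2 fun i => ?_
      rw [← Basis.equivFun_apply, hw]
      exact hl i (Finset.mem_univ _)
    · rw [(equivFun_edgeBasis_eq_iff hv k w l).1 hw, hx, hlast]
    · rw [Fintype.sum_eq_add_sum_subtype_ne l k] at hlast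
      obtain ⟨hk₀, hk₁⟩ := hl k (Finset.mem_univ k)
      simp only [hw]
      exact (Int.ceil_eq_iff.2 ⟨by linarith, by linarith⟩).symm
  · rintro ⟨w, hw, hproj, hlast⟩
    set S := ∑ i, (edgeBasis hv k).equivFun w i
    obtain ⟨l, hl⟩ := (Equiv.funSplitAt k ℝ).surjective (⌈S⌉ - S, (edgeBasis hv k).equivFun w)
    obtain ⟨hlk, hcoord⟩ := Prod.ext_iff.1 hl
    replace hlk : l k = ⌈S⌉ - S := hlk
    replace hcoord : ∀ i : {i // i ≠ k}, l i = (edgeBasis hv k).equivFun w i := congrFun hcoord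
    have hlsum : ∑ i, l i = x (Fin.last n) := by
      rw [Fintype.sum_eq_add_sum_subtype_ne l k, hlk, hlast]
      simp only [hcoord]
      exact sub_add_cancel _ _
    refine ⟨l, fun i _ => ?_, ?_, hlsum.symm⟩
    · by_cases hi : i = k
      · rw [hi, hlk]
        exact ⟨sub_nonneg.2 (Int.le_ceil S), sub_lt_iff_lt_add'.2 (Int.ceil_lt_add_one S)⟩
      · exact hcoord ⟨i, hi⟩ ▸ (ZSpan.mem_fundamentalDomain _).1 hw ⟨i, hi⟩
    · rwa [(equivFun_edgeBasis_eq_iff hv k w l).1 fun i => (hcoord i).symm, hlsum,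
        sub_left_inj] at hproj

theorem ncard_latticeBox_univ :
    (latticeBox (Set.Ico 0 1) v Finset.univ).ncard =
      (↑(latticeOf (convexHull ℝ (Set.range fun i => toReal (v i)))) ∩
        ZSpan.fundamentalDomain (edgeBasis hv k)).ncard := by
  classical
  have hinj : Set.InjOn (fun x => toReal (projectAlong (v k) x))
      (latticeBox (Set.Ico 0 1) v Finset.univ) := by
    intro x hx y hy hxy
    obtain ⟨w, -, hxw, hx⟩ := (mem_latticeBox_univ_iff hv k x).1 hx
    obtain ⟨z, -, hyz, hy⟩ := (mem_latticeBox_univ_iff hv k y).1 hy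
    obtain rfl : w = z := Subtype.ext (hxw.symm.trans (hxy.trans hyz))
    have hlast : x (Fin.last n) = y (Fin.last n) := hx.trans hy.symm
    have hinit : Fin.init x = Fin.init y := by
      simpa [projectAlong, hlast] using toReal_injective hxy
    rw [← Fin.snoc_init_self x, ← Fin.snoc_init_self y, hinit, hlast]
  rw [← hinj.ncard_image, ← Set.ncard_image_of_injective _ Subtype.val_injective]
  congr 1
  ext y
  constructor
  · rintro ⟨x, hx, rfl⟩
    obtain ⟨w, hw, hxw, -⟩ := (mem_latticeBox_univ_iff hv k x).1 hx
    exact ⟨w, ⟨mem_latticeOf.2 ⟨_, hxw⟩, hw⟩, hxw.symm⟩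
  · rintro ⟨w, ⟨hwL, hw⟩, rfl⟩
    obtain ⟨a, ha⟩ := mem_latticeOf.1 hwL
    set z : ℤ := ⌈∑ i, (edgeBasis hv k).equivFun w i⌉ with hz
    let x : Fin (n + 1) → ℤ := Fin.snoc (α := fun _ => ℤ) (a + z • v k) z
    have hxw : toReal (projectAlong (v k) x) = w := by
      rw [← ha]
      simp [projectAlong, x]
    exact ⟨x, (mem_latticeBox_univ_iff hv k x).2 ⟨w, hw, hxw, by simp [x, hz]⟩, hxw⟩

end EdgeLattice

theorem normalizedVolume_convexHull_image {v : ι → Fin n → ℤ}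
    (hv : AffineIndependent ℝ fun i => toReal (v i)) {J : Finset ι} (hJ : J.Nonempty) :
    normalizedVolume (convexHull ℝ ((fun i => toReal (v i)) '' J)) =
      (latticeBox (Set.Ico 0 1) v J).ncard := by
  classical
  obtain ⟨k, hk⟩ := hJ
  have hvJ : AffineIndependent ℝ fun i : J => toReal (v i) :=
    hv.comp_embedding (Function.Embedding.subtype _)
  have hrange : (fun i => toReal (v i)) '' J = Set.range fun i : J => toReal (v i) :=
    Set.image_eq_range _ _
  rw [hrange, normalizedVolume_convexHull_range hvJ ⟨k, hk⟩, ← ncard_latticeBox_univ,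
    latticeBox_univ_coe]

section Support

variable {v : ι → Fin n → ℤ}

theorem finite_latticeBox {T : Set ℝ} (hT : Bornology.IsBounded T) (J : Finset ι) :
    (latticeBox T v J).Finite := by
  obtain ⟨C, hC⟩ := hT.exists_norm_le
  refine (isCompact_closedBall (0 : Fin (n + 1) → ℤ)
    (∑ i ∈ J, C * ‖toReal (lift (v i))‖)).finite_of_discrete.subset ?_
  rintro x ⟨l, hl, hx⟩
  rw [mem_closedBall_zero_iff]
  calc ‖x‖ = ‖toReal x‖ := rfl
    _ ≤ ∑ i ∈ J, ‖l i • toReal (lift (v i))‖ := hx ▸ norm_sum_le _ _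
    _ ≤ ∑ i ∈ J, C * ‖toReal (lift (v i))‖ := Finset.sum_le_sum fun i hi => by
        rw [norm_smul]
        gcongr
        exact hC _ (hl i hi)

theorem mem_latticeBox_Ico_iff {x : Fin (n + 1) → ℤ} {J : Finset ι} :
    x ∈ latticeBox (Set.Ico 0 1) v J ↔ ∃ I ⊆ J, x ∈ latticeBox (Set.Ioo 0 1) v I := by
  classical
  constructor
  · rintro ⟨l, hl, hx⟩
    refine ⟨{i ∈ J | l i ≠ 0}, Finset.filter_subset _ _, l, fun i hi => ?_, ?_⟩
    · obtain ⟨hiJ, hi0⟩ := Finset.mem_filter.1 hi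
      exact ⟨(hl i hiJ).1.lt_of_ne' hi0, (hl i hiJ).2⟩
    · rw [hx, Finset.sum_filter_of_ne fun i _ => left_ne_zero_of_smul]
  · rintro ⟨I, hIJ, l, hl, hx⟩
    refine ⟨fun i => if i ∈ I then l i else 0, fun i _ => ?_, ?_⟩
    · by_cases hi : i ∈ I
      · simpa [hi] using Set.Ioo_subset_Ico_self (hl i hi)
      · simp [hi]
    · simp only [ite_smul, zero_smul]
      rw [hx, Finset.sum_ite_mem, Finset.inter_eq_right.2 hIJ]

theorem linearIndependent_toReal_lift (hv : AffineIndependent ℝ fun i => toReal (v i)) :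
    LinearIndependent ℝ fun i => toReal (lift (v i)) := by
  refine linearIndependent_iff'.2 fun J l hl => ?_
  have hzero : ∀ m, toReal (0 : Fin m → ℤ) = 0 := fun m => funext fun _ => Int.cast_zero
  obtain ⟨hsmul, hsum⟩ := toReal_eq_sum_lift_iff.1 ((hzero _).trans hl.symm)
  exact affineIndependent_iff.1 hv J l (hsum.symm.trans Int.cast_zero) (hsmul.symm.trans (hzero n))

theorem pairwise_disjoint_latticeBox {T : Set ℝ} (hT : 0 ∉ T)
    (hv : AffineIndependent ℝ fun i => toReal (v i)) :
    Pairwise fun I J : Finset ι => Disjoint (latticeBox T v I) (latticeBox T v J) := by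
  classical
  intro I J hne
  rw [Set.disjoint_left]
  rintro x ⟨l, hl, hx⟩ ⟨m, hm, hx'⟩
  have hcoeff : ∀ i ∈ I ∪ J, (if i ∈ I then l i else 0) = if i ∈ J then m i else 0 := by
    refine linearIndependent_iff'ₛ.1 (linearIndependent_toReal_lift hv) _ _ _ ?_
    simp only [ite_smul, zero_smul, Finset.sum_ite_mem, Finset.union_inter_cancel_left,
      Finset.union_inter_cancel_right]
    exact hx.symm.trans hx'
  have hl₀ : ∀ i ∈ I, l i ≠ 0 := fun i hi h₀ => hT (h₀ ▸ hl i hi)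
  have hm₀ : ∀ i ∈ J, m i ≠ 0 := fun i hi h₀ => hT (h₀ ▸ hm i hi)
  exact hne (by grind)

theorem ncard_latticeBox_Ico (hv : AffineIndependent ℝ fun i => toReal (v i)) (J : Finset ι) :
    (latticeBox (Set.Ico 0 1) v J).ncard =
      ∑ I ∈ J.powerset, (latticeBox (Set.Ioo 0 1) v I).ncard := by
  have hunion : latticeBox (Set.Ico 0 1) v J =
      ⋃ I ∈ (J.powerset : Set (Finset ι)), latticeBox (Set.Ioo 0 1) v I := by
    ext x
    simp [mem_latticeBox_Ico_iff]
  rw [hunion, J.powerset.finite_toSet.ncard_biUnion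
    (fun I _ => finite_latticeBox (Metric.isBounded_Ioo 0 1) I)
    ((pairwise_disjoint_latticeBox (by simp) hv).set_pairwise _), finsum_mem_coe_finset]

end Support

theorem normalizedVolume_convexHull_image_eq_sum_s {v : Fin (n + 1) → Fin n → ℤ}
    (hv : AffineIndependent ℝ fun i => toReal (v i)) {J : Finset (Fin (n + 1))}
    (hJ : J.Nonempty) :
    normalizedVolume (convexHull ℝ ((fun i => toReal (v i)) '' J)) =
      ∑ I ∈ J.powerset, (s v I : ℝ) := by
  rw [normalizedVolume_convexHull_image hv hJ, ncard_latticeBox_Ico hv J, Nat.cast_sum]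
  rfl

end LatticeBox

end LatticePolytope

open LatticePolytope in
theorem proposition3p2 (n : ℕ) (v : Fin (n + 1) → Fin n → ℤ)
    (hv : AffineIndependent ℝ (fun i => LatticePolytope.toReal (v i)))
    (P : Set (Fin n → ℝ))
    (hP : P = convexHull ℝ (Set.range (fun i => LatticePolytope.toReal (v i)))) :
    0 ≤ LatticePolytope.c P ∧
      LatticePolytope.c P =
        ∑ I : Finset (Fin (n + 1)), (Nat.choose I.card n : ℝ) * (LatticePolytope.s v I : ℝ) := by
  suffices hc : c P = ∑ I : Finset (Fin (n + 1)), (I.card.choose n : ℝ) * s v I from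
    ⟨hc ▸ Finset.sum_nonneg fun I _ => by positivity, hc⟩
  let B : AffineBasis (Fin (n + 1)) ℝ (Fin n → ℝ) :=
    ⟨fun i => toReal (v i), hv, hv.affineSpan_eq_top_iff_card_eq_finrank_add_one.2 (by simp)⟩
  have hPB : P = convexHull ℝ (Set.range B) := hP
  have hvol : ∀ J : Finset (Fin (n + 1)),
      J.card * normalizedVolume (convexHull ℝ (B '' J)) =
        J.card * ∑ I ∈ J.powerset, (s v I : ℝ) := fun J => by
    rcases J.eq_empty_or_nonempty with rfl | hJ
    · simp
    · exact congrArg _ (normalizedVolume_convexHull_image_eq_sum_s hv hJ)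
  rw [hPB, c_convexHull_range,
    ← sum_neg_one_pow_mul_card_mul_sum_powerset (Fintype.card_fin (n + 1)) fun I => (s v I : ℝ)]
  exact Finset.sum_congr rfl fun J _ => by rw [mul_assoc, mul_assoc, hvol]
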